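/- Let $C\subseteq\mathbb{R}^2$ be a polyhedral set, i.e. $C=\{x : f_i(x)\le 0\ (i=1,\dots,m),\ g_j(x)=0\ (j=1,\dots,k)\}$ for finitely many affine functions $f_i,g_j:\mathbb{R}^2\to\mathbb{R}$, and suppose that $C$ has nonempty interior. An edge of $C$ is a one-dimensional face of $C$, i.e. a set $\{x\in C : \ell(x)=\max_C \ell\}$ of affine dimension one, where $\ell$ is a linear functional on $\mathbb{R}^2$ (so an edge is a segment, a ray or a line); a vertex of $C$ is an extreme point of $C$. Let $$D:=\Bigl(C\setminus\bigcup\{F : F\text{ is an edge of }C\}\Bigr)\cup\{v : v\text{ is a vertex of }C\}$$ be the set $C$ with all its edges removed but all its vertices kept. Then there exists a proper lower semicontinuous convex function $f:\mathbb{R}^2\to\left]-\infty,+\infty\right]$ such that $\operatorname{dom}\partial f=D$, where $\operatorname{dom}\partial f=\{x : \partial f(x)\neq\varnothing\}$, $\partial f(x)=\{u\in\mathbb{R}^2 : \langle y-x,u\rangle+f(x)\le f(y)\ \text{for all } y\in\mathbb{R}^2\}$ if $f(x)<+\infty$, and $\partial f(x)=\varnothing$ if $f(x)=+\infty$. -/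

import Mathlib

namespace NearlyConvex

/-- A polyhedral set: a finite intersection of sets `{f ≤ 0}` and `{g = 0}` with `f`, `g` affine. -/
def IsPolyhedral {n : ℕ} (C : Set (EuclideanSpace ℝ (Fin n))) : Prop :=
  ∃ (m k : ℕ) (f : Fin m → (EuclideanSpace ℝ (Fin n) →ᵃ[ℝ] ℝ))
    (g : Fin k → (EuclideanSpace ℝ (Fin n) →ᵃ[ℝ] ℝ)),
    C = {x | (∀ i, f i x ≤ 0) ∧ ∀ j, g j x = 0}

/-- An edge of `C`: a face of dimension one, i.e. a one-dimensional set of the form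
`{x ∈ C | l attains its maximum over C at x}` for a linear functional `l`. It may be a segment, a
ray, or a line. -/
def IsEdge {n : ℕ} (C F : Set (EuclideanSpace ℝ (Fin n))) : Prop :=
  IsExposed ℝ C F ∧ Module.finrank ℝ (vectorSpan ℝ F) = 1

/-- The set of vertices (extreme points) of `C`. -/
def vertices {n : ℕ} (C : Set (EuclideanSpace ℝ (Fin n))) : Set (EuclideanSpace ℝ (Fin n)) :=
  C.extremePoints ℝ

/-- The set `C` with all its edges removed but all its vertices kept. -/
def removeEdges {n : ℕ} (C : Set (EuclideanSpace ℝ (Fin n))) : Set (EuclideanSpace ℝ (Fin n)) :=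
  (C \ ⋃₀ {F | IsEdge C F}) ∪ vertices C

/-- An extended-real-valued function is proper if it never takes the value `-∞` and is not
identically `+∞`. -/
def IsProper {n : ℕ} (f : EuclideanSpace ℝ (Fin n) → EReal) : Prop :=
  (∀ x, f x ≠ ⊥) ∧ ∃ x, f x ≠ ⊤

/-- An extended-real-valued function is convex if its epigraph is convex. -/
def IsConvex {n : ℕ} (f : EuclideanSpace ℝ (Fin n) → EReal) : Prop :=
  Convex ℝ {p : EuclideanSpace ℝ (Fin n) × ℝ | f p.1 ≤ (p.2 : EReal)}

/-- The subdifferential of `f` at `x`; empty where `f x = +∞`. -/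
def subdifferential {n : ℕ} (f : EuclideanSpace ℝ (Fin n) → EReal)
    (x : EuclideanSpace ℝ (Fin n)) : Set (EuclideanSpace ℝ (Fin n)) :=
  {u | f x < ⊤ ∧ ∀ y, ((inner ℝ (y - x) u : ℝ) : EReal) + f x ≤ f y}

/-- The domain of a set-valued mapping. -/
def setValuedDomain {n : ℕ}
    (A : EuclideanSpace ℝ (Fin n) → Set (EuclideanSpace ℝ (Fin n))) :
    Set (EuclideanSpace ℝ (Fin n)) :=
  {x | (A x).Nonempty}

end NearlyConvex

/-! Since `C` has interior, the equations are void and `C` is `{x | ∀ i, 0 ≤ a i x}`. Take `f = -∑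
i, √(a i * m i)` on `C` and `⊤` outside, where `m i = minPairSum a i` is the minimum of `1` and of
`a i + a j` over the `j` transversal to `i`. Geometric means of nonnegative concave functions are
concave, so `f` is convex. On the line `a i = 0`, `m i` vanishes exactly at corners. Elsewhere on it
the root has infinite slope, which rules out subgradients (`regular_of_subdifferential_nonempty`).
At a corner, or where `a i > 0`, AM-GM gives an affine majorant touching the root
(`Regular.exists_affine_majorant`). Using `a i + a j` instead of `a j` keeps `m i` positive where `a
i > 0`, so that term `i` does no harm on other boundary lines. Finally, being `Regular` for all `i`
describes `D` (`removeEdges_polyhedron`). -/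

namespace NearlyConvex

/-- The Euclidean plane. -/
local notation "E" => EuclideanSpace ℝ (Fin 2)

/-! ### Geometric means, and affine functions on the plane. -/

section Auxiliary

/-- The geometric mean is superadditive with respect to convex combinations. -/
theorem combo_sqrt_mul_le {α β p₁ p₂ q₁ q₂ q : ℝ} (hα : 0 ≤ α) (hβ : 0 ≤ β)
    (hp₁ : 0 ≤ p₁) (hp₂ : 0 ≤ p₂) (hq₁ : 0 ≤ q₁) (hq₂ : 0 ≤ q₂) (hq : α * q₁ + β * q₂ ≤ q) :
    α * √(p₁ * q₁) + β * √(p₂ * q₂) ≤ √((α * p₁ + β * p₂) * q) := by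
  have hp : 0 ≤ α * p₁ + β * p₂ := by positivity
  refine le_trans ?_ (Real.sqrt_le_sqrt (mul_le_mul_of_nonneg_left hq hp))
  apply Real.le_sqrt_of_sq_le
  rw [Real.sqrt_mul hp₁, Real.sqrt_mul hp₂]
  have e₁ := Real.sq_sqrt hp₁
  have e₂ := Real.sq_sqrt hp₂
  have e₃ := Real.sq_sqrt hq₁
  have e₄ := Real.sq_sqrt hq₂
  set r₁ := √p₁
  set r₂ := √p₂
  set s₁ := √q₁
  set s₂ := √q₂
  rw [← e₁, ← e₂, ← e₃, ← e₄]
  -- The difference of the two sides is exactly `α * β * (r₁ * s₂ - r₂ * s₁) ^ 2`.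
  nlinarith [mul_nonneg (mul_nonneg hα hβ) (sq_nonneg (r₁ * s₂ - r₂ * s₁))]

/-- Weighted arithmetic-geometric mean inequality. -/
theorem sqrt_mul_le_weighted {l p q : ℝ} (hl : 0 < l) (hp : 0 ≤ p) (hq : 0 ≤ q) :
    √(p * q) ≤ (l * p + l⁻¹ * q) / 2 := by
  have h : 0 ≤ (l * p + l⁻¹ * q) / 2 := by positivity
  rw [Real.sqrt_le_left h]
  have e : l * l⁻¹ = 1 := mul_inv_cancel₀ hl.ne'
  have : p * q = (l * p) * (l⁻¹ * q) := by
    linear_combination (-(p * q)) * e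
  rw [this]
  nlinarith [sq_nonneg (l * p - l⁻¹ * q)]

/-- Weights for which the weighted arithmetic-geometric mean inequality is an equality. -/
theorem exists_weight_sqrt_mul_eq {p q : ℝ} (h : (p = 0 ∧ q = 0) ∨ (0 < p ∧ 0 < q)) :
    ∃ l : ℝ, 0 < l ∧ √(p * q) = (l * p + l⁻¹ * q) / 2 := by
  rcases h with ⟨rfl, rfl⟩ | ⟨hp, hq⟩
  · exact ⟨1, one_pos, by simp⟩
  · have hp' := Real.sqrt_pos.2 hp
    have hq' := Real.sqrt_pos.2 hq
    -- This weight makes `l * p` and `l⁻¹ * q` both equal to `√(p * q)`.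
    refine ⟨√q / √p, by positivity, ?_⟩
    rw [Real.sqrt_mul hp.le]
    have e₁ := Real.sq_sqrt hp.le
    have e₂ := Real.sq_sqrt hq.le
    set r := √p
    set s := √q
    rw [← e₁, ← e₂]
    field_simp
    ring

theorem affine_combo (h : E →ᵃ[ℝ] ℝ) (x y : E) {α β : ℝ} (hαβ : α + β = 1) :
    h (α • x + β • y) = α * h x + β * h y := by
  simpa using Convex.combo_affine_apply (f := h) (x := x) (y := y) hαβ

theorem affine_add_smul (h : E →ᵃ[ℝ] ℝ) (x d : E) (s : ℝ) :
    h (x + s • d) = h x + s * h.linear d := by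
  have := h.map_vadd x (s • d)
  simp only [vadd_eq_add, map_smul, smul_eq_mul] at this
  rw [add_comm x, this, add_comm]

theorem affine_continuous (h : E →ᵃ[ℝ] ℝ) : Continuous h :=
  h.continuous_of_finiteDimensional

/-- In the plane, a nonzero linear functional has a kernel spanned by any of its nonzero elements. -/
theorem exists_smul_of_linear_eq_zero {l : E →ₗ[ℝ] ℝ} (hl : l ≠ 0) {d e : E} (hd : d ≠ 0)
    (hld : l d = 0) (hle : l e = 0) : ∃ c : ℝ, e = c • d := by
  have h1 : Module.finrank ℝ (LinearMap.ker l) = 1 := by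
    have := Module.Dual.finrank_ker_add_one_of_ne_zero hl
    simp at this
    exact this
  have := (finrank_eq_one_iff_of_nonzero' (⟨d, hld⟩ : LinearMap.ker l)
    (by simpa [Subtype.ext_iff] using hd)).1 h1 ⟨e, hle⟩
  obtain ⟨c, hc⟩ := this
  exact ⟨c, (congrArg Subtype.val hc).symm⟩

theorem exists_ne_zero_linear_eq_zero (l : E →ₗ[ℝ] ℝ) : ∃ d : E, d ≠ 0 ∧ l d = 0 := by
  have h : LinearMap.ker l ≠ ⊥ := LinearMap.ker_ne_bot_of_finrank_lt (by simp)
  obtain ⟨d, hd, hd0⟩ := Submodule.exists_mem_ne_zero_of_ne_bot h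
  exact ⟨d, hd0, hd⟩

end Auxiliary

/-! ### Polyhedra, transversal constraints and corners. -/

section Polyhedron

variable {ι : Type*} (a : ι → E →ᵃ[ℝ] ℝ)

/-- The polyhedron on which all the functions `a i` are nonnegative. -/
def polyhedron : Set E := {x | ∀ i, 0 ≤ a i x}

/-- The linear parts of `a i` and `a j` are linearly independent. -/
def Transversal (i j : ι) : Prop :=
  ∀ d, (a i).linear d = 0 → (a j).linear d = 0 → d = 0

/-- The constraint `i` is trivial, or inactive at `x`, or `x` is a corner on its boundary line. -/
def Regular (i : ι) (x : E) : Prop :=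
  (a i).linear = 0 ∨ 0 < a i x ∨ ∃ j, Transversal a i j ∧ a j x = 0

open Classical in
/-- `a i + a j` for transversal constraints, and the constant `1` otherwise. -/
noncomputable def pairSum (i j : ι) : E →ᵃ[ℝ] ℝ :=
  if Transversal a i j then a i + a j else AffineMap.const ℝ E 1

variable {a}

theorem pairSum_of_transversal {i j : ι} (h : Transversal a i j) (x : E) :
    pairSum a i j x = a i x + a j x := by
  simp [pairSum, h]

theorem pairSum_of_not_transversal {i j : ι} (h : ¬ Transversal a i j) (x : E) :
    pairSum a i j x = 1 := by
  simp [pairSum, h]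

theorem pairSum_nonneg {x : E} (hx : x ∈ polyhedron a) (i j : ι) : 0 ≤ pairSum a i j x := by
  by_cases h : Transversal a i j
  · rw [pairSum_of_transversal h]
    exact add_nonneg (hx i) (hx j)
  · rw [pairSum_of_not_transversal h]
    exact zero_le_one

theorem convex_polyhedron : Convex ℝ (polyhedron a) := by
  intro x hx y hy α β hα hβ hαβ i
  rw [affine_combo _ _ _ hαβ]
  exact add_nonneg (mul_nonneg hα (hx i)) (mul_nonneg hβ (hy i))

theorem isClosed_polyhedron : IsClosed (polyhedron a) := by
  simp only [polyhedron, Set.ofPred_forall]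
  exact isClosed_iInter fun i => isClosed_le continuous_const (affine_continuous (a i))

/-- A point of the polyhedron on two transversal boundary lines is a vertex. -/
theorem mem_vertices_of_transversal {i j : ι} {x : E} (hx : x ∈ polyhedron a)
    (ht : Transversal a i j) (hi : a i x = 0) (hj : a j x = 0) :
    x ∈ vertices (polyhedron a) := by
  refine ⟨hx, fun y hy z hz hseg => ?_⟩
  obtain ⟨α, β, hα, hβ, hαβ, rfl⟩ := hseg
  have hzero : ∀ k, a k (α • y + β • z) = 0 → a k y = 0 ∧ a k z = 0 := fun k hk => by
    rw [affine_combo _ _ _ hαβ] at hk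
    have h1 := hy k
    have h2 := hz k
    constructor <;> nlinarith [mul_nonneg hα.le h1, mul_nonneg hβ.le h2]
  have hlin : ∀ k, a k y = 0 ∧ a k z = 0 → (a k).linear (z - y) = 0 := fun k hk => by
    have := affine_add_smul (a k) y (z - y) 1
    simp only [one_smul, add_sub_cancel, one_mul, hk.1, hk.2, zero_add] at this
    exact this.symm
  have h0 := ht (z - y) (hlin i (hzero i hi)) (hlin j (hzero j hj))
  rw [sub_eq_zero] at h0
  subst h0
  rw [← add_smul, hαβ, one_smul]

/-! ### The function `rootFun`: properness, semicontinuity, convexity. -/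

variable [Fintype ι] (a)

/-- The smallest of the functions `pairSum a i j`. -/
noncomputable def minPairSum (i : ι) (x : E) : ℝ :=
  Finset.univ.inf' ⟨i, Finset.mem_univ i⟩ fun j => pairSum a i j x

/-- A concave function with infinite slope at the points of the line `a i = 0` that are not
corners. -/
noncomputable def rootTerm (i : ι) (x : E) : ℝ := √(a i x * minPairSum a i x)

open Classical in
/-- The convex function which is `-∑ i, rootTerm a i` on the polyhedron and `+∞` elsewhere. -/
noncomputable def rootFun (x : E) : EReal :=
  if x ∈ polyhedron a then ((-∑ i, rootTerm a i x : ℝ) : EReal) else ⊤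

variable {a}

theorem minPairSum_le (i j : ι) (x : E) : minPairSum a i x ≤ pairSum a i j x :=
  Finset.inf'_le _ (Finset.mem_univ j)

theorem exists_minPairSum_eq (i : ι) (x : E) : ∃ j, minPairSum a i x = pairSum a i j x := by
  obtain ⟨j, -, hj⟩ := Finset.exists_mem_eq_inf' (⟨i, Finset.mem_univ i⟩ : Finset.univ.Nonempty)
    fun j => pairSum a i j x
  exact ⟨j, hj⟩

theorem minPairSum_nonneg {x : E} (hx : x ∈ polyhedron a) (i : ι) : 0 ≤ minPairSum a i x := by
  obtain ⟨j, hj⟩ := exists_minPairSum_eq (a := a) i x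
  exact hj ▸ pairSum_nonneg hx i j

/-- A minimum of affine functions is concave: use the one attaining the minimum at the combination.
-/
theorem combo_minPairSum_le (i : ι) (x y : E) {α β : ℝ} (hα : 0 ≤ α) (hβ : 0 ≤ β)
    (hαβ : α + β = 1) :
    α * minPairSum a i x + β * minPairSum a i y ≤ minPairSum a i (α • x + β • y) := by
  obtain ⟨j, hj⟩ := exists_minPairSum_eq (a := a) i (α • x + β • y)
  rw [hj, affine_combo _ _ _ hαβ]
  gcongr <;> exact minPairSum_le i j _

theorem continuous_rootTerm (i : ι) : Continuous (rootTerm a i) := by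
  refine Real.continuous_sqrt.comp ((affine_continuous _).mul ?_)
  exact Continuous.finset_inf'_apply _ fun j _ => affine_continuous (pairSum a i j)

theorem combo_rootTerm_le (i : ι) {x y : E} (hx : x ∈ polyhedron a) (hy : y ∈ polyhedron a)
    {α β : ℝ} (hα : 0 ≤ α) (hβ : 0 ≤ β) (hαβ : α + β = 1) :
    α * rootTerm a i x + β * rootTerm a i y ≤ rootTerm a i (α • x + β • y) := by
  unfold rootTerm
  rw [affine_combo _ _ _ hαβ]
  exact combo_sqrt_mul_le hα hβ (hx i) (hy i) (minPairSum_nonneg hx i) (minPairSum_nonneg hy i)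
    (combo_minPairSum_le i x y hα hβ hαβ)

theorem rootFun_of_mem {x : E} (hx : x ∈ polyhedron a) :
    rootFun a x = ((-∑ i, rootTerm a i x : ℝ) : EReal) := if_pos hx

theorem rootFun_of_notMem {x : E} (hx : x ∉ polyhedron a) : rootFun a x = ⊤ := if_neg hx

theorem isProper_rootFun (h : (polyhedron a).Nonempty) : IsProper (rootFun a) := by
  constructor
  · intro x
    by_cases hx : x ∈ polyhedron a
    · rw [rootFun_of_mem hx]
      exact EReal.coe_ne_bot _
    · rw [rootFun_of_notMem hx]
      exact top_ne_bot
  · obtain ⟨x, hx⟩ := h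
    exact ⟨x, by rw [rootFun_of_mem hx]; exact EReal.coe_ne_top _⟩

theorem lowerSemicontinuous_rootFun : LowerSemicontinuous (rootFun a) := by
  have hc : Continuous fun x : E => ((-∑ i, rootTerm a i x : ℝ) : EReal) :=
    continuous_coe_real_ereal.comp
      (continuous_finsetSum _ fun i _ => continuous_rootTerm i).neg
  intro x y hy
  by_cases hx : x ∈ polyhedron a
  · rw [rootFun_of_mem hx] at hy
    filter_upwards [hc.continuousAt.eventually (lt_mem_nhds hy)] with z hz
    by_cases hzP : z ∈ polyhedron a
    · rwa [rootFun_of_mem hzP]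
    · rw [rootFun_of_notMem hzP]
      exact lt_of_lt_of_le hz le_top
  · rw [rootFun_of_notMem hx] at hy
    filter_upwards [isClosed_polyhedron.isOpen_compl.mem_nhds hx] with z hz
    rwa [rootFun_of_notMem hz]

theorem mem_polyhedron_of_rootFun_lt_top {x : E} (h : rootFun a x < ⊤) : x ∈ polyhedron a := by
  by_contra hx
  exact h.ne (rootFun_of_notMem hx)

theorem isConvex_rootFun : IsConvex (rootFun a) := by
  rintro ⟨x, r⟩ hx ⟨y, s⟩ hy α β hα hβ hαβ
  simp only [Set.mem_ofPred_eq, Prod.smul_mk, Prod.mk_add_mk, smul_eq_mul] at hx hy ⊢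
  have hxP := mem_polyhedron_of_rootFun_lt_top (hx.trans_lt (EReal.coe_lt_top r))
  have hyP := mem_polyhedron_of_rootFun_lt_top (hy.trans_lt (EReal.coe_lt_top s))
  rw [rootFun_of_mem hxP, EReal.coe_le_coe_iff] at hx
  rw [rootFun_of_mem hyP, EReal.coe_le_coe_iff] at hy
  rw [rootFun_of_mem (convex_polyhedron hxP hyP hα hβ hαβ), EReal.coe_le_coe_iff]
  have h : α * ∑ i, rootTerm a i x + β * ∑ i, rootTerm a i y
      ≤ ∑ i, rootTerm a i (α • x + β • y) := by
    rw [Finset.mul_sum, Finset.mul_sum, ← Finset.sum_add_distrib]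
    exact Finset.sum_le_sum fun i _ => combo_rootTerm_le i hxP hyP hα hβ hαβ
  nlinarith [mul_le_mul_of_nonneg_left hx hα, mul_le_mul_of_nonneg_left hy hβ]

/-! ### Existence and non-existence of subgradients. -/

/-- At a regular point, `rootTerm a i` has an affine majorant that touches it. -/
theorem Regular.exists_affine_majorant {i : ι} {x : E} (hx : x ∈ polyhedron a)
    (h : Regular a i x) :
    ∃ g : E →ᵃ[ℝ] ℝ, g x = rootTerm a i x ∧ ∀ y ∈ polyhedron a, rootTerm a i y ≤ g y := by
  -- Replace the minimum by an affine function attaining it at `x`, then apply AM-GM with the weight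
  -- that is tight at `x`. Such a weight needs both factors zero or both positive.
  have key : ∀ j, minPairSum a i x = pairSum a i j x →
      ((a i x = 0 ∧ pairSum a i j x = 0) ∨ (0 < a i x ∧ 0 < pairSum a i j x)) →
      ∃ g : E →ᵃ[ℝ] ℝ, g x = rootTerm a i x ∧ ∀ y ∈ polyhedron a, rootTerm a i y ≤ g y := by
    intro j hj hpos
    obtain ⟨l, hl, hle⟩ := exists_weight_sqrt_mul_eq hpos
    refine ⟨(l / 2) • a i + (l⁻¹ / 2) • pairSum a i j, ?_, ?_⟩
    · simp only [rootTerm, hj, hle, AffineMap.coe_add, AffineMap.coe_smul, Pi.add_apply,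
        Pi.smul_apply, smul_eq_mul]
      ring
    · intro y hy
      simp only [rootTerm, AffineMap.coe_add, AffineMap.coe_smul, Pi.add_apply,
        Pi.smul_apply, smul_eq_mul]
      calc √(a i y * minPairSum a i y) ≤ √(a i y * pairSum a i j y) :=
            Real.sqrt_le_sqrt (mul_le_mul_of_nonneg_left (minPairSum_le i j y) (hy i))
        _ ≤ (l * a i y + l⁻¹ * pairSum a i j y) / 2 :=
            sqrt_mul_le_weighted hl (hy i) (pairSum_nonneg hy i j)
        _ = _ := by ring
  obtain ⟨j, hj⟩ := exists_minPairSum_eq (a := a) i x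
  rcases (hx i).lt_or_eq with hpos | hzero
  · refine key j hj (Or.inr ⟨hpos, ?_⟩)
    by_cases ht : Transversal a i j
    · rw [pairSum_of_transversal ht]
      exact add_pos_of_pos_of_nonneg hpos (hx j)
    · rw [pairSum_of_not_transversal ht]
      exact one_pos
  · rcases h with hlin | hpos | ⟨k, hk, hk0⟩
    · have hconst : ∀ y, a i y = 0 := fun y => by
        have := affine_add_smul (a i) x (y - x) 1
        simpa [hlin, ← hzero] using this
      exact ⟨0, by simp [rootTerm, ← hzero], fun y _ => by simp [rootTerm, hconst y]⟩
    · exact absurd hzero hpos.ne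
    · refine key j hj (Or.inl ⟨hzero.symm, le_antisymm ?_ (pairSum_nonneg hx i j)⟩)
      rw [← hj]
      refine (minPairSum_le i k x).trans ?_
      rw [pairSum_of_transversal hk, hk0, ← hzero, add_zero]

/-- Minus the sum of the touching affine majorants is an affine minorant of `rootFun a`, exact at
`x`; the Riesz vector of its linear part is a subgradient. -/
theorem subdifferential_rootFun_nonempty {x : E} (hx : x ∈ polyhedron a)
    (h : ∀ i, Regular a i x) : (subdifferential (rootFun a) x).Nonempty := by
  choose g hgx hg using fun i => (h i).exists_affine_majorant hx
  let l : E →L[ℝ] ℝ := LinearMap.toContinuousLinearMap (-∑ i, (g i).linear)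
  refine ⟨(InnerProductSpace.toDual ℝ E).symm l, ?_, ?_⟩
  · rw [rootFun_of_mem hx]
    exact EReal.coe_lt_top _
  · intro y
    by_cases hy : y ∈ polyhedron a
    · rw [rootFun_of_mem hx, rootFun_of_mem hy, ← EReal.coe_add, EReal.coe_le_coe_iff,
        real_inner_comm, InnerProductSpace.toDual_symm_apply]
      have e : l (y - x) = ∑ i, (rootTerm a i x - g i y) := by
        simp only [l, LinearMap.coe_toContinuousLinearMap', LinearMap.neg_apply,
          LinearMap.sum_apply, ← Finset.sum_neg_distrib]
        refine Finset.sum_congr rfl fun i _ => ?_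
        have := affine_add_smul (g i) x (y - x) 1
        simp only [one_smul, add_sub_cancel, one_mul] at this
        rw [this, hgx i]
        ring
      rw [e, Finset.sum_sub_distrib]
      linarith [Finset.sum_le_sum fun i (_ : i ∈ Finset.univ) => hg i y hy]
    · rw [rootFun_of_notMem hy]
      exact le_top

/-- A nonconstant affine function that is nonnegative on a set is positive in its interior. -/
theorem affine_pos_of_mem_interior {C : Set E} {h : E →ᵃ[ℝ] ℝ} (hlin : h.linear ≠ 0)
    (hC : ∀ y ∈ C, 0 ≤ h y) {z : E} (hz : z ∈ interior C) : 0 < h z := by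
  refine (hC z (interior_subset hz)).lt_of_ne fun h0 => hlin ?_
  ext1 d
  have hcont : Filter.Tendsto (fun s : ℝ => z + s • d) (nhds 0) (nhds z) := by
    have : Continuous fun s : ℝ => z + s • d := by fun_prop
    simpa using this.tendsto 0
  have hev := hcont.eventually (mem_interior_iff_mem_nhds.1 hz)
  obtain ⟨ε, hε, hball⟩ := Metric.eventually_nhds_iff.1 hev
  -- If `h z = 0`, nonnegativity at `z ± (ε / 2) • d` forces the slope along `d` to vanish.
  have h1 := hC _ (hball (y := ε / 2) (by simp [abs_of_pos hε]; linarith))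
  have h2 := hC _ (hball (y := -(ε / 2)) (by simp [abs_of_pos hε]; linarith))
  rw [affine_add_smul, ← h0] at h1 h2
  simp only [LinearMap.zero_apply]
  nlinarith

/-- At a boundary point that is not a corner there is no subgradient. -/
theorem regular_of_subdifferential_nonempty (hint : (interior (polyhedron a)).Nonempty) {x : E}
    (h : (subdifferential (rootFun a) x).Nonempty) (i : ι) : Regular a i x := by
  obtain ⟨u, hfin, hu⟩ := h
  have hx := mem_polyhedron_of_rootFun_lt_top hfin
  by_contra hreg
  simp only [Regular, not_or, not_exists, not_and, not_lt] at hreg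
  obtain ⟨hlin, hle, htr⟩ := hreg
  have hi0 : a i x = 0 := le_antisymm hle (hx i)
  obtain ⟨z, hz⟩ := hint
  have hzP := interior_subset hz
  have hiz : 0 < a i z := affine_pos_of_mem_interior (C := polyhedron a) hlin (fun y hy => hy i) hz
  have hm : 0 < minPairSum a i x := by
    obtain ⟨j, hj⟩ := exists_minPairSum_eq (a := a) i x
    rw [hj]
    by_cases ht : Transversal a i j
    · rw [pairSum_of_transversal ht, hi0, zero_add]
      exact (hx j).lt_of_ne fun h => htr j ht h.symm
    · rw [pairSum_of_not_transversal ht]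
      exact one_pos
  set K := √(a i z * (minPairSum a i x / 2)) with hK
  have hKpos : 0 < K := Real.sqrt_pos.2 (by positivity)
  set T := ∑ k, rootTerm a k x with hT
  set w : ℝ := inner ℝ (z - x) u with hw
  have hT0 : ∀ k, ∀ y : E, 0 ≤ rootTerm a k y := fun k y => Real.sqrt_nonneg _
  -- Move a fraction `r ^ 2` from `x` towards `z`: term `i` gains at least `r * K`, while the others
  -- lose at most order `r ^ 2`. The bound `r ^ 2 ≤ 1 / 2` preserves half of `minPairSum a i x`.
  have main : ∀ r : ℝ, 0 < r → r ^ 2 ≤ 1 / 2 → K ≤ r * (T - w) := by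
    intro r hr hr2
    have hs : 0 ≤ r ^ 2 := sq_nonneg r
    have hs1 : 0 ≤ 1 - r ^ 2 := by linarith
    have hsum : (1 - r ^ 2) + r ^ 2 = 1 := by ring
    set y : E := (1 - r ^ 2) • x + r ^ 2 • z with hy
    have hyP : y ∈ polyhedron a := convex_polyhedron hx hzP hs1 hs hsum
    have hsub := hu y
    have hyx : y - x = r ^ 2 • (z - x) := by rw [hy]; module
    rw [rootFun_of_mem hx, rootFun_of_mem hyP, ← EReal.coe_add, EReal.coe_le_coe_iff, hyx,
      real_inner_smul_left] at hsub
    have hother : ∀ k, (1 - r ^ 2) * rootTerm a k x ≤ rootTerm a k y := fun k => by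
      have := combo_rootTerm_le k hx hzP hs1 hs hsum
      have := mul_nonneg hs (hT0 k z)
      linarith
    have hxi : rootTerm a i x = 0 := by simp [rootTerm, hi0]
    have hyi : r * K ≤ rootTerm a i y := by
      have e1 : r * K = √(r ^ 2 * (a i z * (minPairSum a i x / 2))) := by
        rw [Real.sqrt_mul hs, Real.sqrt_sq hr.le]
      rw [e1, rootTerm]
      apply Real.sqrt_le_sqrt
      have e2 : a i y = r ^ 2 * a i z := by
        rw [hy, affine_combo _ _ _ hsum, hi0, mul_zero, zero_add]
      rw [e2, mul_assoc]
      have e3 := combo_minPairSum_le (a := a) i x z hs1 hs hsum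
      have e4 := mul_nonneg hs (minPairSum_nonneg hzP i)
      have e5 : minPairSum a i x / 2 ≤ minPairSum a i y := by nlinarith
      gcongr
    have htot : (1 - r ^ 2) * T + r * K ≤ ∑ k, rootTerm a k y := by
      classical
      rw [hT, Finset.mul_sum, ← Finset.add_sum_erase _ _ (Finset.mem_univ i),
        ← Finset.add_sum_erase (a := i) _ (fun k => rootTerm a k y) (Finset.mem_univ i), hxi]
      have := Finset.sum_le_sum fun k (_ : k ∈ Finset.univ.erase i) => hother k
      linarith
    have : r * K ≤ r * (r * (T - w)) := by nlinarith
    exact le_of_mul_le_mul_left this hr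
  have hTw : 0 < T - w := by
    have := main (1 / 2) (by norm_num) (by norm_num)
    linarith
  -- For this `r`, `main` would give `K ≤ K / 2`.
  have hr : 0 < min (1 / 2) (K / (2 * (T - w))) := by positivity
  have h1 := main _ hr (by nlinarith [min_le_left (1 / 2) (K / (2 * (T - w)))])
  have h2 := mul_le_mul_of_nonneg_right (min_le_right (1 / 2) (K / (2 * (T - w)))) hTw.le
  have h3 : K / (2 * (T - w)) * (T - w) = K / 2 := by field_simp
  linarith

theorem setValuedDomain_subdifferential_rootFun (hint : (interior (polyhedron a)).Nonempty) :
    setValuedDomain (subdifferential (rootFun a)) =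
      {x | x ∈ polyhedron a ∧ ∀ i, Regular a i x} := by
  ext x
  refine ⟨fun h => ⟨?_, regular_of_subdifferential_nonempty hint h⟩,
    fun h => subdifferential_rootFun_nonempty h.1 h.2⟩
  obtain ⟨u, hfin, -⟩ := h
  exact mem_polyhedron_of_rootFun_lt_top hfin

/-! ### Edges and vertices in terms of `Regular`. -/

/-- If every constraint active at `x` is constant in the direction `d`, then a small segment
around `x` in the direction `d` stays in the polyhedron. -/
theorem exists_segment_subset {x d : E} (hx : x ∈ polyhedron a)
    (hd : ∀ j, a j x = 0 → (a j).linear d = 0) :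
    ∃ ε : ℝ, 0 < ε ∧ x + ε • d ∈ polyhedron a ∧ x + (-ε) • d ∈ polyhedron a := by
  have hev : ∀ᶠ s : ℝ in nhds 0, x + s • d ∈ polyhedron a := by
    simp only [polyhedron, Set.mem_ofPred_eq]
    refine Filter.eventually_all.2 fun j => ?_
    rcases (hx j).lt_or_eq with hpos | hzero
    · have hc : Continuous fun s : ℝ => a j (x + s • d) :=
        (affine_continuous (a j)).comp (by fun_prop)
      have h0 : 0 < a j (x + (0 : ℝ) • d) := by simpa using hpos
      filter_upwards [hc.continuousAt.eventually (lt_mem_nhds h0)] with s hs using hs.le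
    · refine Filter.Eventually.of_forall fun s => ?_
      rw [affine_add_smul, hd j hzero.symm, ← hzero]
      simp
  obtain ⟨ε, hε, hball⟩ := Metric.eventually_nhds_iff.1 hev
  exact ⟨ε / 2, by positivity, hball (by simp [abs_of_pos hε]; linarith),
    hball (by simp [abs_of_pos hε]; linarith)⟩

/-- Around a boundary point that is not a corner, the polyhedron contains a segment of the
boundary line. -/
theorem exists_segment_of_not_regular {i : ι} {x : E} (hx : x ∈ polyhedron a)
    (h : ¬ Regular a i x) :
    ∃ d : E, d ≠ 0 ∧ (a i).linear d = 0 ∧ x + d ∈ polyhedron a ∧ x - d ∈ polyhedron a := by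
  simp only [Regular, not_or, not_exists, not_and, not_lt] at h
  obtain ⟨hlin, -, htr⟩ := h
  obtain ⟨d, hd0, hd⟩ := exists_ne_zero_linear_eq_zero (a i).linear
  obtain ⟨ε, hε, h1, h2⟩ := exists_segment_subset (d := d) hx fun j hj => by
    -- No active constraint is transversal to `i`, so each is constant along the line `a i = 0`.
    have : ¬ Transversal a i j := fun ht => htr j ht hj
    simp only [Transversal, not_forall] at this
    obtain ⟨e, he, he', he0⟩ := this
    obtain ⟨c, rfl⟩ := exists_smul_of_linear_eq_zero hlin he0 he hd
    rw [map_smul, he', smul_zero]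
  refine ⟨ε • d, smul_ne_zero hε.ne' hd0, by rw [map_smul, hd, smul_zero], h1, ?_⟩
  rwa [sub_eq_add_neg, ← neg_smul]

/-- A boundary line that meets the polyhedron in a point which is not a corner cuts out an
edge. -/
theorem isEdge_of_not_regular {i : ι} {x : E} (hx : x ∈ polyhedron a) (h : ¬ Regular a i x) :
    IsEdge (polyhedron a) {y ∈ polyhedron a | a i y = 0} := by
  obtain ⟨d, hd0, hd, h1, -⟩ := exists_segment_of_not_regular hx h
  simp only [Regular, not_or, not_exists, not_and, not_lt] at h
  obtain ⟨hlin, hle, -⟩ := h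
  have hi0 : a i x = 0 := le_antisymm hle (hx i)
  have hval : ∀ y, a i y = (a i).linear (y - x) := fun y => by
    simpa [hi0] using affine_add_smul (a i) x (y - x) 1
  refine ⟨fun _ => ⟨LinearMap.toContinuousLinearMap (-(a i).linear), ?_⟩, ?_⟩
  · ext y
    simp only [Set.mem_ofPred_eq, LinearMap.coe_toContinuousLinearMap', LinearMap.neg_apply]
    refine and_congr_right fun hy => ⟨fun h0 z hz => ?_, fun h0 => ?_⟩
    · have h3 := hz i
      rw [hval, map_sub] at h0 h3
      linarith
    · have h3 := h0 x hx
      have h4 := hy i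
      rw [hval, map_sub] at h4 ⊢
      linarith
  · rw [finrank_eq_one_iff']
    have hmem : d ∈ vectorSpan ℝ {y ∈ polyhedron a | a i y = 0} := by
      have := vsub_mem_vectorSpan ℝ (s := {y ∈ polyhedron a | a i y = 0})
        (p₁ := x + d) (p₂ := x) ⟨h1, by rw [hval]; simpa using hd⟩ ⟨hx, hi0⟩
      simpa using this
    have hker : vectorSpan ℝ {y ∈ polyhedron a | a i y = 0} ≤ LinearMap.ker (a i).linear := by
      rw [vectorSpan_def, Submodule.span_le]
      rintro _ ⟨y, hy, z, hz, rfl⟩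
      have h3 := hy.2
      have h4 := hz.2
      rw [hval, map_sub] at h3 h4
      simp only [vsub_eq_sub, SetLike.mem_coe, LinearMap.mem_ker, map_sub]
      linarith
    refine ⟨⟨d, hmem⟩, by simpa [Subtype.ext_iff] using hd0, fun w => ?_⟩
    obtain ⟨c, hc⟩ := exists_smul_of_linear_eq_zero hlin hd0 hd (hker w.2)
    exact ⟨c, Subtype.ext hc.symm⟩

theorem mem_interior_of_forall {x : E} (h : ∀ i, (a i).linear = 0 ∨ 0 < a i x)
    (hx : x ∈ polyhedron a) : x ∈ interior (polyhedron a) := by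
  rw [mem_interior_iff_mem_nhds]
  change ∀ᶠ y in nhds x, ∀ i, 0 ≤ a i y
  refine Filter.eventually_all.2 fun i => ?_
  rcases h i with hlin | hpos
  · refine Filter.Eventually.of_forall fun y => ?_
    have := affine_add_smul (a i) x (y - x) 1
    simp only [one_smul, add_sub_cancel, hlin, LinearMap.zero_apply, mul_zero, add_zero] at this
    exact this ▸ hx i
  · filter_upwards [(affine_continuous (a i)).continuousAt.eventually (lt_mem_nhds hpos)]
      with y hy using hy.le

/-- An interior point lies on no edge. -/
theorem IsEdge.notMem_interior {C F : Set E} (hF : IsEdge C F) {x : E} (hxF : x ∈ F) :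
    x ∉ interior C := by
  intro hx
  obtain ⟨l, hl⟩ := hF.1 ⟨x, hxF⟩
  have hmax : ∀ y ∈ C, l y ≤ l x := by
    rw [hl] at hxF
    exact hxF.2
  have hl0 : (l : E →ₗ[ℝ] ℝ) = 0 := by
    by_contra hne
    let g : E →ᵃ[ℝ] ℝ := AffineMap.const ℝ E (l x) - (l : E →ₗ[ℝ] ℝ).toAffineMap
    have hg : ∀ y, g y = l x - l y := fun y => by simp [g]
    have := affine_pos_of_mem_interior (h := g) (C := C) (by simpa [g] using hne)
      (fun y hy => by rw [hg]; exact sub_nonneg.2 (hmax y hy)) hx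
    rw [hg, sub_self] at this
    exact lt_irrefl _ this
  have hl0' : ∀ y, l y = 0 := fun y => by simpa using LinearMap.congr_fun hl0 y
  -- A functional maximal at an interior point is zero, so `F` would be all of `C`, which spans the
  -- plane.
  have hFC : F = C := by
    rw [hl]
    ext y
    simp [hl0']
  have hspan : affineSpan ℝ C = ⊤ :=
    top_le_iff.1 ((isOpen_interior.affineSpan_eq_top ⟨x, hx⟩).symm.le.trans
      (affineSpan_mono ℝ interior_subset))
  have h2 := hF.2
  rw [hFC, ← direction_affineSpan, hspan, AffineSubspace.direction_top, finrank_top] at h2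
  simp at h2

/-- A non-regular point lies on an edge and inside a segment of it, so it is removed and is no
vertex. A regular point either has no nontrivial active constraint, hence is interior, or lies on
two transversal lines, hence is a vertex. -/
theorem removeEdges_polyhedron :
    removeEdges (polyhedron a) = {x | x ∈ polyhedron a ∧ ∀ i, Regular a i x} := by
  ext x
  constructor
  · rintro (⟨hx, hedge⟩ | hv)
    · refine ⟨hx, fun i => ?_⟩
      by_contra hreg
      refine hedge ⟨_, isEdge_of_not_regular hx hreg, hx, ?_⟩
      simp only [Regular, not_or, not_lt] at hreg
      exact le_antisymm hreg.2.1 (hx i)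
    · refine ⟨hv.1, fun i => ?_⟩
      by_contra hreg
      obtain ⟨d, hd0, -, h1, h2⟩ := exists_segment_of_not_regular hv.1 hreg
      have hseg : x ∈ openSegment ℝ (x + d) (x - d) :=
        ⟨1 / 2, 1 / 2, by norm_num, by norm_num, by norm_num, by module⟩
      have := hv.2 h1 h2 hseg
      exact hd0 (by simpa using this)
  · rintro ⟨hx, hreg⟩
    by_cases h : ∀ i, (a i).linear = 0 ∨ 0 < a i x
    · left
      refine ⟨hx, ?_⟩
      rintro ⟨F, hF, hxF⟩
      exact IsEdge.notMem_interior hF hxF (mem_interior_of_forall h hx)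
    · right
      simp only [not_forall, not_or, not_lt] at h
      obtain ⟨i, hlin, hle⟩ := h
      rcases hreg i with h1 | h1 | ⟨j, hj, hj0⟩
      · exact absurd h1 hlin
      · exact absurd h1 hle.not_gt
      · exact mem_vertices_of_transversal hx hj (le_antisymm hle (hx i)) hj0

/-- A polyhedral set with nonempty interior is given by inequalities alone. -/
theorem IsPolyhedral.exists_eq_polyhedron {C : Set E} (hC : IsPolyhedral C)
    (hint : (interior C).Nonempty) :
    ∃ (m : ℕ) (a : Fin m → E →ᵃ[ℝ] ℝ), C = polyhedron a := by
  obtain ⟨m, k, f, g, rfl⟩ := hC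
  obtain ⟨z, hz⟩ := hint
  refine ⟨m, fun i => -f i, ?_⟩
  -- An affine function that vanishes on a set with interior vanishes everywhere.
  have hg : ∀ j y, g j y = 0 := by
    intro j y
    have hz0 : g j z = 0 := (interior_subset hz).2 j
    have hlin : (g j).linear = 0 := by
      by_contra hne
      have := affine_pos_of_mem_interior hne (fun y hy => (hy.2 j).ge) hz
      exact this.ne' hz0
    have := affine_add_smul (g j) z (y - z) 1
    simpa [hlin, hz0] using this
  ext x
  simp [polyhedron, hg]

end Polyhedron

end NearlyConvex

theorem mainTheorem10 (C : Set (EuclideanSpace ℝ (Fin 2)))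
    (hC : NearlyConvex.IsPolyhedral C) (hint : (interior C).Nonempty) :
    ∃ f : EuclideanSpace ℝ (Fin 2) → EReal,
      NearlyConvex.IsProper f ∧ LowerSemicontinuous f ∧ NearlyConvex.IsConvex f ∧
        NearlyConvex.setValuedDomain (NearlyConvex.subdifferential f) =
          NearlyConvex.removeEdges C := by
  obtain ⟨m, a, rfl⟩ := hC.exists_eq_polyhedron hint
  exact ⟨NearlyConvex.rootFun a, NearlyConvex.isProper_rootFun (hint.mono interior_subset),
    NearlyConvex.lowerSemicontinuous_rootFun, NearlyConvex.isConvex_rootFun,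
    (NearlyConvex.setValuedDomain_subdifferential_rootFun hint).trans
      NearlyConvex.removeEdges_polyhedron.symm⟩
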